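/- Let $\varphi=(1+\sqrt5)/2$. The Hurt--Sada array $A[n,k]$ ($n,k\ge 0$) is defined as follows: row $0$ is $0,1,2,3,\ldots$, and for $n\ge 1$ row $n$ is obtained from row $n-1$ (a permutation of $\mathbb{N}=\{0,1,2,\ldots\}$) by moving the unique entry $n$ by $n$ positions to the right, the $n$ entries it jumps over each moving one place to the left. For $n\ge 0$, the $n$-th antidiagonal is the sequence $A[0,n],A[1,n-1],\ldots,A[n,0]$; its entry in row $i$ is $A[i,n-i]$. There are functions $h,h',r:\mathbb{N}\to\mathbb{N}$ such that for every $n\ge 0$: (a) $0\le h(n)\le h'(n)\le n$, and $h(n)<h'(n)$ if $n\ge 2$; (b) the $n$-th antidiagonal starts with $A[0,n]=n$ and decreases by exactly $1$ from each row to the next among the rows $0,1,\ldots,h(n)-1$; (c) it has the value $r(n)$ in the rows $h(n),h(n)+1,\ldots,h'(n)$ and in no other row; (d) among the rows $h'(n)+1,\ldots,n$ it decreases by exactly $1$ from each row to the next, and $A[n,0]=0$; (e) the whole antidiagonal is nonincreasing. Moreover, $(r(n))_{n\ge 1}$ is the sequence A026272 of the OEIS, that is, for every $n\ge 1$, $r(n)$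 is the least integer $k\ge 1$ such that $n-k-1\ge 1$, $r(n-k-1)=k$, and $k$ occurs exactly once among $r(1),\ldots,r(n-1)$; if there is no such $k$, then $r(n)$ is the least positive integer that does not occur among $r(1),\ldots,r(n-1)$. Finally, for all $n\ge 0$, $$h(n)=2n+4-\lfloor (n+3)\varphi\rfloor,\qquad h'(n)=\lfloor (n+2)/\varphi\rfloor-1 .$$ -/

import Mathlib

/-- `shiftRight f p m` is the sequence obtained from `f` by moving the entry in position `p`
by `m` positions to the right; the `m` entries it jumps over each move one place to the left. -/
def shiftRight (f : ℕ → ℕ) (p m : ℕ) : ℕ → ℕ := fun j =>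
  if j < p then f j
  else if j < p + m then f (j + 1)
  else if j = p + m then f p
  else f j

/-- The Hurt-Sada array: `hurtSada n k` is the entry in row `n` and column `k`.
Row `0` is `0, 1, 2, …`; row `n + 1` arises from row `n` by moving the entry `n + 1` by `n + 1`
positions to the right. Every row is a bijection of `ℕ` (`hurtSada_bijective`), so the set of
positions below has exactly one element. -/
noncomputable def hurtSada : ℕ → ℕ → ℕ
  | 0 => fun k => k
  | n + 1 => shiftRight (hurtSada n) (sInf {i : ℕ | hurtSada n i = n + 1}) (n + 1)

theorem shiftRight_bijective {f : ℕ → ℕ} (hf : Function.Bijective f) (p m : ℕ) :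
    Function.Bijective (shiftRight f p m) := by
  constructor
  · intro a b hab
    unfold shiftRight at hab
    split_ifs at hab <;> have := hf.1 hab <;> omega
  · intro y
    obtain ⟨x, rfl⟩ := hf.2 y
    by_cases h1 : x < p
    · exact ⟨x, by simp [shiftRight, h1]⟩
    · by_cases h2 : x = p
      · exact ⟨p + m, by simp [shiftRight, h2]⟩
      · by_cases h3 : x ≤ p + m
        · refine ⟨x - 1, ?_⟩
          have e : x - 1 + 1 = x := by omega
          have a1 : ¬ x - 1 < p := by omega
          have a2 : x - 1 < p + m := by omega
          simp [shiftRight, a1, a2, e]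
        · have a2 : ¬ x < p + m := by omega
          have a3 : ¬ x = p + m := by omega
          exact ⟨x, by simp [shiftRight, a2, a3]⟩

theorem hurtSada_bijective (n : ℕ) : Function.Bijective (hurtSada n) := by
  induction n with
  | zero => exact Function.bijective_id
  | succ n ih => exact shiftRight_bijective ih _ _

/-- The entry in row `i` of the `n`-th antidiagonal `A[0,n], A[1,n-1], …, A[n,0]`
(meaningful for `i ≤ n`). -/
noncomputable def antidiag (n i : ℕ) : ℕ := hurtSada i (n - i)

/-- The positive integers `k` such that `k = a (n - k - 1)` is the only appearance of `k`
among the terms `a 1, …, a (n - 1)`. -/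
def onceBefore (a : ℕ → ℕ) (n : ℕ) : Set ℕ :=
  {k | 1 ≤ k ∧ k + 2 ≤ n ∧ ∀ j, 1 ≤ j → j < n → (a j = k ↔ j = n - k - 1)}

/-- The positive integers that do not appear among `a 1, …, a (n - 1)`. -/
def notBefore (a : ℕ → ℕ) (n : ℕ) : Set ℕ :=
  {k | 1 ≤ k ∧ ∀ j, 1 ≤ j → j < n → a j ≠ k}

/-- `a 1, a 2, …` is the sequence A026272 of the OEIS, which is defined recursively: `a n` is the
least `k` such that `k = a (n - k - 1)` is the only appearance of `k` so far and, if there is no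
such `k`, the least positive integer that has not appeared yet. The sequence has offset `1`;
the value `a 0` is not constrained. -/
def IsA026272 (a : ℕ → ℕ) : Prop :=
  ∀ n, 1 ≤ n →
    ((onceBefore a n).Nonempty → IsLeast (onceBefore a n) (a n)) ∧
    (onceBefore a n = ∅ → IsLeast (notBefore a n) (a n))

/-! Write `L m = ⌊m φ⌋`. By Beatty's theorem for `φ` and `φ²`, each `N ≥ 2` is exactly one of `L
(m+1)`, `L (m+1) + (m+1)`, for a unique `m`; with `N = n + 2` this `m` is `r n`. The heart is
`hurtSada_eq`: row `n` is the identity outside an interval of columns, where the entry depends only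
on `n + k`. It propagates because a jumped entry goes one row down and one column left, so it stays
on its antidiagonal. Hence each antidiagonal is `n - i` outside a block of rows and constant inside
it. All comparisons rest on the duality `lowerWythoff_lt_iff_add_le`, which expresses `φ² = φ + 1`
and makes them linear. -/

/-- The lower Wythoff sequence `⌊m φ⌋`. -/
noncomputable def lowerWythoff (m : ℕ) : ℕ := ⌊(m : ℝ) * Real.goldenRatio⌋₊

theorem lowerWythoff_lt_iff {m x : ℕ} :
    lowerWythoff m < x ↔ (m : ℝ) * Real.goldenRatio < x :=
  Nat.floor_lt (by have := Real.goldenRatio_pos; positivity)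

theorem natCast_ne_mul_goldenRatio {m : ℕ} (hm : 0 < m) (x : ℕ) :
    (x : ℝ) ≠ m * Real.goldenRatio := fun h =>
  (Real.goldenRatio_irrational.natCast_mul hm.ne').ne_nat x h.symm

theorem le_lowerWythoff_iff {m x : ℕ} (hm : 0 < m) :
    x ≤ lowerWythoff m ↔ (x : ℝ) < m * Real.goldenRatio := by
  rw [← not_lt, lowerWythoff_lt_iff, not_lt]
  exact ⟨fun h => lt_of_le_of_ne h (natCast_ne_mul_goldenRatio hm x), le_of_lt⟩

/-- Since `1 / φ = φ - 1`, the inequalities `m φ < x` and `m + x < x φ` are equivalent. -/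
theorem lowerWythoff_lt_iff_add_le {m x : ℕ} (hx : 0 < x) :
    lowerWythoff m < x ↔ m + x ≤ lowerWythoff x := by
  rw [lowerWythoff_lt_iff, le_lowerWythoff_iff hx]
  push_cast
  have h0 := Real.goldenRatio_pos
  have h1 : ((m : ℝ) + x - x * Real.goldenRatio) * Real.goldenRatio
      = m * Real.goldenRatio - x := by
    linear_combination (-(x : ℝ)) * Real.goldenRatio_sq
  constructor
  · intro h
    by_contra hc
    have := mul_nonneg (sub_nonneg.2 (not_lt.1 hc)) h0.le
    linarith
  · intro h
    have := mul_pos (sub_pos.2 h) h0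
    linarith

/-- Fibonacci quotients, sharp enough to settle small arguments of `lowerWythoff` and the linear
estimates. -/
theorem goldenRatio_bounds : 8 / 5 < Real.goldenRatio ∧ Real.goldenRatio < 13 / 8 := by
  have h1 := Real.goldenRatio_sq
  have h2 := Real.one_lt_goldenRatio
  constructor <;> nlinarith

theorem le_lowerWythoff (m : ℕ) : 8 * m / 5 ≤ lowerWythoff m := by
  apply Nat.le_floor
  have h1 : ((8 * m / 5 : ℕ) : ℝ) ≤ ((8 * m : ℕ) : ℝ) / (5 : ℕ) := Nat.cast_div_le
  push_cast at h1
  nlinarith [goldenRatio_bounds.1, (Nat.cast_nonneg m : (0 : ℝ) ≤ m)]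

theorem lowerWythoff_le (m : ℕ) : lowerWythoff m ≤ 13 * m / 8 := by
  rw [Nat.le_div_iff_mul_le (by norm_num)]
  have h1 : (lowerWythoff m : ℝ) ≤ m * Real.goldenRatio :=
    Nat.floor_le (by have := Real.goldenRatio_pos; positivity)
  have h2 : ((lowerWythoff m * 8 : ℕ) : ℝ) ≤ ((13 * m : ℕ) : ℝ) := by
    push_cast
    nlinarith [goldenRatio_bounds.2, (Nat.cast_nonneg m : (0 : ℝ) ≤ m)]
  exact_mod_cast h2

theorem lowerWythoff_succ (m : ℕ) :
    lowerWythoff m + 1 ≤ lowerWythoff (m + 1) ∧ lowerWythoff (m + 1) ≤ lowerWythoff m + 2 := by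
  have hb := goldenRatio_bounds
  have h1 : (lowerWythoff m : ℝ) ≤ m * Real.goldenRatio :=
    Nat.floor_le (by have := Real.goldenRatio_pos; positivity)
  have h2 : (m : ℝ) * Real.goldenRatio < lowerWythoff m + 1 := Nat.lt_floor_add_one _
  constructor
  · apply Nat.le_floor
    push_cast
    linarith
  · rw [← Nat.lt_succ_iff, lowerWythoff_lt_iff]
    push_cast
    linarith

theorem lowerWythoff_strictMono : StrictMono lowerWythoff :=
  strictMono_nat_of_lt_succ fun m => (lowerWythoff_succ m).1

/-! ### Complementarity of the Wythoff sequences -/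

/-- Every integer `N ≥ 2` is a term of the lower or of the upper Wythoff sequence. -/
theorem exists_wythoff {N : ℕ} (hN : 2 ≤ N) :
    ∃ m, lowerWythoff (m + 1) = N ∨ lowerWythoff (m + 1) + (m + 1) = N := by
  have hex : ∃ m, N ≤ lowerWythoff (m + 1) :=
    ⟨N, (Nat.le_succ N).trans lowerWythoff_strictMono.le_apply⟩
  have hfind := Nat.find_spec hex
  have hmin := @Nat.find_min _ _ hex
  generalize Nat.find hex = m at hfind hmin
  rcases hfind.eq_or_lt with h | h
  · exact ⟨m, Or.inl h.symm⟩
  · have hm : m ≠ 0 := by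
      rintro rfl
      have := lowerWythoff_le 1
      simp only [zero_add] at h
      omega
    have h1 := hmin (Nat.sub_one_lt hm)
    rw [Nat.sub_add_cancel (Nat.pos_of_ne_zero hm)] at h1
    have h2 := (lowerWythoff_succ m).2
    have h3 : m ≤ lowerWythoff m := lowerWythoff_strictMono.le_apply
    -- Here `N = L m + 1` lies in a gap of `L`; duality at `m` and `m + 1` gives `L (N - m) = m`.
    refine ⟨N - m - 1, Or.inr ?_⟩
    rw [show N - m - 1 + 1 = N - m by omega]
    have h4 := lowerWythoff_lt_iff_add_le (m := N - m) (x := m + 1) (by omega)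
    have h5 := lowerWythoff_lt_iff_add_le (m := N - m) (x := m) (by omega)
    omega

/-- With `a = L k`, duality gives `L a < a + k < L (a + 1)`. -/
theorem lowerWythoff_ne_add {m k : ℕ} (hk : lowerWythoff k ≠ 0) :
    lowerWythoff m ≠ lowerWythoff k + k := by
  intro h
  have h1 := lowerWythoff_lt_iff_add_le (m := k) (x := lowerWythoff k + 1) (by omega)
  have h2 := lowerWythoff_lt_iff_add_le (m := k) (x := lowerWythoff k) (by omega)
  have h3 : lowerWythoff k < m := lowerWythoff_strictMono.lt_iff_lt.1 (by omega)
  have h4 : m < lowerWythoff k + 1 := lowerWythoff_strictMono.lt_iff_lt.1 (by omega)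
  omega

theorem exists_wythoff_add_two (n : ℕ) :
    ∃ m, lowerWythoff (m + 1) = n + 2 ∨ lowerWythoff (m + 1) + (m + 1) = n + 2 :=
  exists_wythoff (by omega)

/-- `wythoffRow n` is the `m` for which `n + 2` is `⌊(m + 1) φ⌋` or `⌊(m + 1) φ²⌋`. -/
noncomputable def wythoffRow (n : ℕ) : ℕ := (exists_wythoff_add_two n).choose

theorem wythoffRow_eq_iff {n m : ℕ} :
    wythoffRow n = m ↔
      lowerWythoff (m + 1) = n + 2 ∨ lowerWythoff (m + 1) + (m + 1) = n + 2 := by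
  have hs := (exists_wythoff_add_two n).choose_spec
  change lowerWythoff (wythoffRow n + 1) = n + 2 ∨
    lowerWythoff (wythoffRow n + 1) + (wythoffRow n + 1) = n + 2 at hs
  constructor
  · rintro rfl
    exact hs
  · intro hm
    generalize wythoffRow n = k at hs
    have hne : ∀ j, lowerWythoff (j + 1) ≠ 0 := fun j => by
      have := (lowerWythoff_succ j).1
      omega
    have hmono : StrictMono fun j => lowerWythoff (j + 1) + (j + 1) := fun i j hij =>
      add_lt_add (lowerWythoff_strictMono (Nat.succ_lt_succ hij)) (Nat.succ_lt_succ hij)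
    rcases hs with hs | hs <;> rcases hm with hm | hm
    · exact Nat.succ_injective (lowerWythoff_strictMono.injective (hs.trans hm.symm))
    · exact absurd (hs.trans hm.symm) (lowerWythoff_ne_add (hne m))
    · exact absurd (hm.trans hs.symm) (lowerWythoff_ne_add (hne k))
    · exact hmono.injective (hs.trans hm.symm)

/-! ### Closed form of the array -/

/-- The closed form of the Hurt-Sada array. -/
theorem hurtSada_eq (n k : ℕ) :
    hurtSada n k =
      if lowerWythoff (n + 1) ≤ n + 1 + k ∧ k < lowerWythoff (n + 2) then wythoffRow (n + k)
      else k := by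
  induction n generalizing k with
  | zero =>
    split_ifs with h
    · symm
      change wythoffRow (0 + k) = k
      have h2 := lowerWythoff_le 2
      have l1 := le_lowerWythoff 1
      have u1 := lowerWythoff_le 1
      have l2 := le_lowerWythoff 2
      have l3 := le_lowerWythoff 3
      have u3 := lowerWythoff_le 3
      rw [wythoffRow_eq_iff]
      simp only [zero_add] at h
      obtain rfl | rfl | rfl : k = 0 ∨ k = 1 ∨ k = 2 := by omega
      all_goals simp only [zero_add, Nat.reduceAdd]; omega
    · rfl
  | succ n ih =>
    have hs1 := lowerWythoff_succ (n + 1)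
    have hs2 := lowerWythoff_succ (n + 2)
    have hb1 := le_lowerWythoff (n + 2)
    simp only [add_assoc, Nat.reduceAdd] at hs1 hs2
    have hp : hurtSada n (lowerWythoff (n + 2) - (n + 2)) = n + 1 := by
      rw [ih, if_pos (by omega), wythoffRow_eq_iff]
      left
      change lowerWythoff (n + 2) = _
      omega
    have hInf : sInf {i : ℕ | hurtSada n i = n + 1} = lowerWythoff (n + 2) - (n + 2) := by
      have : {i : ℕ | hurtSada n i = n + 1} = {lowerWythoff (n + 2) - (n + 2)} := by
        ext i
        exact ⟨fun hi => (hurtSada_bijective n).1 (hi.trans hp.symm), fun hi => hi ▸ hp⟩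
      rw [this, csInf_singleton]
    change shiftRight (hurtSada n) (sInf {i : ℕ | hurtSada n i = n + 1}) (n + 1) k = _
    rw [hInf, shiftRight, hp]
    simp only [add_assoc, Nat.reduceAdd]
    have d1 := lowerWythoff_lt_iff_add_le (m := k + 1) (x := n + 2) (by omega)
    have d2 := lowerWythoff_lt_iff_add_le (m := k + 1) (x := n + 1) (by omega)
    have d3 := lowerWythoff_lt_iff_add_le (m := n + 2) (x := k + 1) (by omega)
    have d4 := lowerWythoff_lt_iff_add_le (m := n + 3) (x := k + 1) (by omega)
    split_ifs with c1 c2 c3 c4 c5 c6 c7 <;> try omega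
    -- Columns left of the jump: those leaving the interval satisfy `L (k + 1) = n + 1`, so they
    -- already hold `k`.
    · rw [ih]
      split_ifs with c
      · rw [wythoffRow_eq_iff]
        omega
      · rfl
    -- Jumped entries stay on their antidiagonal.
    · rw [ih, if_pos (by omega)]
      congr 1
      omega
    -- The moved entry `n + 1` goes from its lower Wythoff antidiagonal to its upper one.
    · symm
      rw [wythoffRow_eq_iff]
      right
      change lowerWythoff (n + 2) + (n + 2) = _
      omega
    -- Columns entering the interval on the right: `L (k + 1) = n + k + 3`.
    · rw [ih, if_neg (by omega)]
      symm
      rw [wythoffRow_eq_iff]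
      omega
    · rw [ih, if_neg (by omega)]

/-! ### The constant block of an antidiagonal -/

/-- The first row of the constant block of the `n`-th antidiagonal. -/
noncomputable def blockStart (n : ℕ) : ℕ := 2 * n + 4 - lowerWythoff (n + 3)

/-- The last row of the constant block of the `n`-th antidiagonal. -/
noncomputable def blockEnd (n : ℕ) : ℕ := lowerWythoff (n + 2) - (n + 3)

/-- Duality once bounds `i` above; applied twice to the second inequality, it bounds `i` below. -/
theorem mem_block_iff {n i : ℕ} (hi : i ≤ n) :
    (lowerWythoff (i + 1) ≤ n + 1 ∧ n - i < lowerWythoff (i + 2)) ↔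
      blockStart n ≤ i ∧ i ≤ blockEnd n := by
  have h1 := lowerWythoff_lt_iff_add_le (m := i + 1) (x := n + 2) (by omega)
  have h2 := lowerWythoff_lt_iff_add_le (m := i + 2) (x := n - i + 1) (by omega)
  have h3 := lowerWythoff_lt_iff_add_le (m := n - i + 1) (x := n + 3) (by omega)
  have h4 := le_lowerWythoff (n + 2)
  unfold blockStart blockEnd
  omega

theorem antidiag_eq {n i : ℕ} (hi : i ≤ n) :
    antidiag n i = if blockStart n ≤ i ∧ i ≤ blockEnd n then wythoffRow n else n - i := by
  rw [antidiag, hurtSada_eq, show i + 1 + (n - i) = n + 1 by omega,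
    show i + (n - i) = n by omega]
  simp only [mem_block_iff hi]

/-- The antidiagonal without its constant block would take the value `wythoffRow n` inside it. -/
theorem wythoffRow_mem_block (n : ℕ) :
    wythoffRow n ≤ n ∧ blockStart n ≤ n - wythoffRow n ∧ n - wythoffRow n ≤ blockEnd n := by
  have hs := wythoffRow_eq_iff.1 (rfl : wythoffRow n = wythoffRow n)
  generalize wythoffRow n = k at hs
  have hb := le_lowerWythoff (k + 1)
  have hu := lowerWythoff_le (k + 1)
  have hk : k ≤ n := by omega
  refine ⟨hk, (mem_block_iff (n.sub_le k)).1 ?_⟩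
  obtain ⟨i, rfl⟩ := Nat.exists_eq_add_of_le hk
  rw [show k + i - k = i by omega, show k + i - i = k by omega]
  have d1 := lowerWythoff_lt_iff_add_le (m := k + 1) (x := i + 1) (by omega)
  have d2 := lowerWythoff_lt_iff_add_le (m := k + 1) (x := i + 2) (by omega)
  have d3 := lowerWythoff_lt_iff_add_le (m := i + 1) (x := k + 1) (by omega)
  have d4 := lowerWythoff_lt_iff_add_le (m := i + 2) (x := k + 1) (by omega)
  omega

theorem block_bounds (n : ℕ) :
    blockStart n ≤ blockEnd n ∧ blockEnd n ≤ n ∧ (2 ≤ n → blockStart n < blockEnd n) := by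
  have h1 := le_lowerWythoff (n + 2)
  have h2 := le_lowerWythoff (n + 3)
  have h3 := lowerWythoff_le (n + 2)
  unfold blockStart blockEnd
  rcases lt_or_ge n 8 with h | h
  · interval_cases n <;> omega
  · omega

/-! ### The recursion of A026272 -/

/-- A value `k ≥ 1` occurs exactly at the indices `L (k+1) - 2` and `L (k+1) + k - 1`, whose
distance `k + 1` is the gap the recursion demands. -/
theorem mem_onceBefore_wythoffRow {n k : ℕ} :
    k ∈ onceBefore wythoffRow n ↔ 1 ≤ k ∧ lowerWythoff (k + 1) + (k + 1) = n + 2 := by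
  have hb := le_lowerWythoff (k + 1)
  simp only [onceBefore, Set.mem_ofPred_eq, wythoffRow_eq_iff]
  constructor
  · rintro ⟨h1, h2, h3⟩
    refine ⟨h1, ?_⟩
    have h4 := (h3 (n - k - 1) (by omega) (by omega)).2 rfl
    by_contra hne
    have h5 := h3 (lowerWythoff (k + 1) - 2) (by omega) (by omega)
    have h6 := h3 (lowerWythoff (k + 1) + (k + 1) - 2) (by omega)
    omega
  · rintro ⟨h1, h2⟩
    refine ⟨h1, by omega, fun j hj hjn => ?_⟩
    omega

theorem mem_notBefore_wythoffRow {n k : ℕ} :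
    k ∈ notBefore wythoffRow n ↔ 1 ≤ k ∧ n + 2 ≤ lowerWythoff (k + 1) := by
  have hb := le_lowerWythoff (k + 1)
  simp only [notBefore, Set.mem_ofPred_eq, ne_eq, wythoffRow_eq_iff]
  constructor
  · rintro ⟨h1, h2⟩
    refine ⟨h1, ?_⟩
    have := h2 (lowerWythoff (k + 1) - 2) (by omega)
    omega
  · rintro ⟨h1, h2⟩
    refine ⟨h1, fun j hj hjn => ?_⟩
    omega

theorem isA026272_wythoffRow : IsA026272 wythoffRow := by
  intro n hn
  have hs := wythoffRow_eq_iff.1 (rfl : wythoffRow n = wythoffRow n)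
  have hpos : 1 ≤ wythoffRow n := by
    by_contra h
    rw [show wythoffRow n = 0 by omega] at hs
    have := lowerWythoff_le 1
    simp only [zero_add] at hs
    omega
  constructor
  · rintro ⟨k, hk⟩
    have key : ∀ l ∈ onceBefore wythoffRow n, wythoffRow n = l := fun l hl =>
      wythoffRow_eq_iff.2 (Or.inr (mem_onceBefore_wythoffRow.1 hl).2)
    exact ⟨key k hk ▸ hk, fun l hl => (key l hl).le⟩
  · intro he
    have hlow : lowerWythoff (wythoffRow n + 1) = n + 2 := hs.resolve_right fun h => by
      have : wythoffRow n ∈ onceBefore wythoffRow n := mem_onceBefore_wythoffRow.2 ⟨hpos, h⟩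
      simp [he] at this
    refine ⟨mem_notBefore_wythoffRow.2 ⟨hpos, hlow.ge⟩, fun l hl => ?_⟩
    have h1 := (mem_notBefore_wythoffRow.1 hl).2
    rw [← hlow, lowerWythoff_strictMono.le_iff_le] at h1
    exact Nat.le_of_succ_le_succ h1

theorem floor_mul_goldenRatio (m : ℕ) :
    ⌊(m : ℝ) * Real.goldenRatio⌋ = (lowerWythoff m : ℤ) :=
  (Int.natCast_floor_eq_floor (by have := Real.goldenRatio_pos; positivity)).symm

theorem floor_div_goldenRatio (m : ℕ) :
    ⌊(m : ℝ) / Real.goldenRatio⌋ = (lowerWythoff m : ℤ) - m := by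
  have h : (m : ℝ) / Real.goldenRatio = m * Real.goldenRatio - m := by
    rw [div_eq_iff Real.goldenRatio_ne_zero]
    linear_combination (-(m : ℝ)) * Real.goldenRatio_sq
  rw [h, Int.floor_sub_natCast, floor_mul_goldenRatio]

theorem blockStart_cast (n : ℕ) :
    (blockStart n : ℤ) = 2 * (n : ℤ) + 4 - ⌊((n : ℝ) + 3) * Real.goldenRatio⌋ := by
  have h := floor_mul_goldenRatio (n + 3)
  have hle := lowerWythoff_le (n + 3)
  push_cast at h
  rw [h]
  unfold blockStart
  omega

theorem blockEnd_cast (n : ℕ) :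
    (blockEnd n : ℤ) = ⌊((n : ℝ) + 2) / Real.goldenRatio⌋ - 1 := by
  have h := floor_div_goldenRatio (n + 2)
  have hle := le_lowerWythoff (n + 2)
  push_cast at h
  rw [h]
  unfold blockEnd
  omega

theorem theorem11 :
    ∃ h h' r : ℕ → ℕ,
      (∀ n : ℕ,
        -- the rows `h n, …, h' n` form a nonempty block of rows of the antidiagonal,
        -- with at least two rows if `2 ≤ n`
        h n ≤ h' n ∧ h' n ≤ n ∧ (2 ≤ n → h n < h' n) ∧
        -- it starts with `n` and decreases by `1` per row up to row `h n - 1`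
        antidiag n 0 = n ∧
        (∀ i, i + 1 < h n → antidiag n i = antidiag n (i + 1) + 1) ∧
        -- it has the value `r n` in the rows `h n, …, h' n`, and in no other row
        (∀ i, i ≤ n → (antidiag n i = r n ↔ h n ≤ i ∧ i ≤ h' n)) ∧
        -- from row `h' n + 1` on it decreases by `1` per row, down to `0` in row `n`
        (∀ i, h' n + 1 ≤ i → i < n → antidiag n i = antidiag n (i + 1) + 1) ∧
        antidiag n n = 0 ∧
        -- the whole antidiagonal is nonincreasing
        (∀ i, i < n → antidiag n (i + 1) ≤ antidiag n i)) ∧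
      IsA026272 r ∧
      (∀ n : ℕ, (h n : ℤ) = 2 * (n : ℤ) + 4 - ⌊((n : ℝ) + 3) * Real.goldenRatio⌋) ∧
      (∀ n : ℕ, (h' n : ℤ) = ⌊((n : ℝ) + 2) / Real.goldenRatio⌋ - 1) := by
  refine ⟨blockStart, blockEnd, wythoffRow, fun n => ?_, isA026272_wythoffRow,
    blockStart_cast, blockEnd_cast⟩
  obtain ⟨hb1, hb2, hb3⟩ := block_bounds n
  -- Outside the block, `n - i` could equal `r n` only in row `n - r n`, which is in the block; this
  -- also gives monotonicity at the block's ends.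
  obtain ⟨hr1, hr2, hr3⟩ := wythoffRow_mem_block n
  refine ⟨hb1, hb2, hb3, rfl, fun i hi => ?_, fun i hi => ?_, fun i hi hin => ?_, ?_,
    fun i hi => ?_⟩
  · rw [antidiag_eq (by omega), antidiag_eq (by omega), if_neg (by omega), if_neg (by omega)]
    omega
  · rw [antidiag_eq hi]
    split_ifs with c
    · simpa using c
    · omega
  · rw [antidiag_eq (by omega), antidiag_eq (by omega), if_neg (by omega), if_neg (by omega)]
    omega
  · rw [antidiag_eq le_rfl]
    split_ifs with c
    · have hu := lowerWythoff_le (n + 2)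
      have hl := le_lowerWythoff (n + 2)
      have hc := c.2
      unfold blockEnd at hc
      omega
    · omega
  · rw [antidiag_eq (by omega), antidiag_eq (by omega)]
    split_ifs <;> omega
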